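/- Let $n\ge 1$, let $A$ be a complex $n\times n$ matrix and let $C$ be a Hermitian $n\times n$ matrix with eigenvalues $c_1\le c_2\le\dots\le c_n$ (counted with multiplicity). Let $D\subseteq\mathbb R$ contain all $c_j$, let $g:D\to\mathbb R$ be strictly increasing, let $h:D\to\mathbb R$ be any function, and let $f$ be a real function with $f=h\circ g^{-1}$ on $g(D)$ (that is, $f(g(x))=h(x)$ for $x\in D$) which is concave on the interval $[g(c_1),g(c_n)]$ and differentiable at every point $g(c_j)$ as a function on that interval (so one-sided differentiability suffices at the end points). Put $\alpha=f'(g(c_1))$, $\beta=f'(g(c_n))$, and let $\phi=(1+\sqrt5)/2$ be the golden ratio. Write $[X,Y]=XY-YX$ and $\|X\|_1=\operatorname{Tr}(X^*X)^{1/2}$ (trace norm), and let $g(C)$, $h(C)$ be defined by the functional calculus. Then $$ \|[A,h(C)]\|_1\;\le\;\Big((\alpha-\beta)+\min\Big(|\beta|+\phi^{-1}\sum_{j=1}^{n}\big(\alpha-f'(g(c_j))\big),\;|\alpha|+\phi^{-1}\sum_{j=1}^{n}\big(f'(g(c_j))-\beta\big)\Big)\Big)\,\|[A,g(C)]\|_1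 . $$ In particular, if $[A,g(C)]\neq 0$, the ratio $\|[A,h(C)]\|_1/\|[A,g(C)]\|_1$ is at most the expression in the outer parentheses. (If $g(c_1)=g(c_n)$, the derivatives at this single point are to be read as arbitrary real numbers, and both sides vanish.) -/

import Mathlib

open scoped Matrix

/-- The trace norm (Schatten norm with exponent `1`) of a complex square matrix:
`‖M‖₁ = Tr (Mᴴ M)^{1/2}`, the square root being taken by the functional calculus of the
positive semidefinite matrix `Mᴴ M`. -/
noncomputable def traceNorm {n : ℕ} (M : Matrix (Fin n) (Fin n) ℂ) : ℝ :=
  (((Matrix.isHermitian_conjTranspose_mul_self M).cfc Real.sqrt).trace).re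

/-- `c` is the list of the eigenvalues of `C`, with multiplicities, in non-decreasing order. -/
def IsSortedSpectrum {n : ℕ} (C : Matrix (Fin n) (Fin n) ℂ) (c : Fin n → ℝ) : Prop :=
  Monotone c ∧ C.charpoly = ∏ j, (Polynomial.X - Polynomial.C (c j : ℂ))

open scoped Matrix.Norms.L2Operator

/-! In an eigenbasis of `C` the commutator with `g(C)` has entries `A j k * (g_k - g_j)`. So `[A,
h(C)]` is the entrywise product of `[A, g(C)]` with the Loewner matrix `L` of `f` at the points
`g(c_j)`, and it suffices to bound `L` as a Schur multiplier for the trace norm. As `L` is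
symmetric, duality reduces this to the operator norm (`SchurBound.traceNorm_le`).

Concavity puts `L j k` between `f' (b k)` and `f' (b j)`. After subtracting the constant `β`, or
subtracting `L` from `α`, and ordering the indices suitably, the diagonal increases and bounds the
later entries of its row from below. For such matrices `SchurBound.of_monotone` inducts on the size:
removing the constant `m 0` clears the corner, and `SchurBound.border` compares the bordered
multiplier with the 2×2 matrix `[[0, a], [a, μ]]`. The golden ratio enters through the size of that
matrix's norm. -/

open Matrix in
/-- A square matrix of operator norm at most `K` is detected on vectors. -/
theorem Matrix.l2_opNorm_le_of_forall {ι : Type*} [Fintype ι] [DecidableEq ι]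
    {M : Matrix ι ι ℂ} {K : ℝ} (hK : 0 ≤ K)
    (h : ∀ v : ι → ℂ, ‖WithLp.toLp 2 (M *ᵥ v)‖ ≤ K * ‖WithLp.toLp 2 v‖) : ‖M‖ ≤ K := by
  rw [← l2_opNorm_toEuclideanCLM]
  exact ContinuousLinearMap.opNorm_le_bound _ hK fun x => h x.ofLp

open Matrix in
theorem Matrix.norm_toLp_mulVec_le {ι : Type*} [Fintype ι] [DecidableEq ι]
    (M : Matrix ι ι ℂ) (v : ι → ℂ) :
    ‖WithLp.toLp 2 (M *ᵥ v)‖ ≤ ‖M‖ * ‖WithLp.toLp 2 v‖ :=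
  l2_opNorm_mulVec M (WithLp.toLp 2 v)

theorem norm_toLp_le_of_forall_norm_le {ι : Type*} [Fintype ι] {u v : ι → ℂ} {a : ℝ} (ha : 0 ≤ a)
    (h : ∀ i, ‖u i‖ ≤ a * ‖v i‖) : ‖WithLp.toLp 2 u‖ ≤ a * ‖WithLp.toLp 2 v‖ := by
  refine (sq_le_sq₀ (by positivity) (by positivity)).mp ?_
  rw [mul_pow, EuclideanSpace.norm_sq_eq, EuclideanSpace.norm_sq_eq, Finset.mul_sum]
  refine Finset.sum_le_sum fun i _ => ?_
  rw [← mul_pow]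
  exact pow_le_pow_left₀ (norm_nonneg _) (h i) 2

theorem norm_sq_toLp_fin_succ {n : ℕ} (v : Fin (n + 1) → ℂ) :
    ‖WithLp.toLp 2 v‖ ^ 2 = ‖v 0‖ ^ 2 + ‖WithLp.toLp 2 (fun k : Fin n => v k.succ)‖ ^ 2 := by
  rw [EuclideanSpace.norm_sq_eq, EuclideanSpace.norm_sq_eq, Fin.sum_univ_succ]

open Matrix in
/-- Entries are bounded by the operator norm. -/
theorem Matrix.norm_entry_le_l2_opNorm {ι : Type*} [Fintype ι] [DecidableEq ι]
    (M : Matrix ι ι ℂ) (i j : ι) : ‖M i j‖ ≤ ‖M‖ := by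
  have h := norm_toLp_mulVec_le M (Pi.single j 1)
  have h2 := PiLp.norm_apply_le (WithLp.toLp 2 (M *ᵥ Pi.single j 1)) i
  simp at h h2
  exact h2.trans h

open Matrix in
/-- Compression along an injective map of indices does not increase the operator norm. -/
theorem Matrix.l2_opNorm_submatrix_le {ι κ : Type*} [Fintype ι] [DecidableEq ι] [Fintype κ]
    [DecidableEq κ] (M : Matrix ι ι ℂ) {e : κ → ι} (he : Function.Injective e) :
    ‖M.submatrix e e‖ ≤ ‖M‖ := by
  refine l2_opNorm_le_of_forall (norm_nonneg _) fun v => ?_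
  have hx : ∀ (F : ι → ℝ), (∀ i, i ∉ Set.range e → F i = 0) → ∑ i, F i = ∑ k, F (e k) := by
    intro F hF
    exact (Finset.sum_of_injOn e he.injOn (by simp) (by simpa using hF) (by simp)).symm
  have hy : ∀ (F : ι → ℂ), (∀ i, i ∉ Set.range e → F i = 0) → ∑ i, F i = ∑ k, F (e k) := by
    intro F hF
    exact (Finset.sum_of_injOn e he.injOn (by simp) (by simpa using hF) (by simp)).symm
  set w : ι → ℂ := Function.extend e v 0 with hw
  have hwe : ∀ k, w (e k) = v k := fun k => he.extend_apply _ _ _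
  have hw0 : ∀ i, i ∉ Set.range e → w i = 0 := fun i hi => Function.extend_apply' _ _ _ hi
  have h1 : ‖WithLp.toLp 2 w‖ = ‖WithLp.toLp 2 v‖ := by
    rw [EuclideanSpace.norm_eq, EuclideanSpace.norm_eq,
      hx _ fun i hi => by simp [hw0 i hi]]
    simp [hwe]
  have h2 : ∀ k, (M.submatrix e e *ᵥ v) k = (M *ᵥ w) (e k) := by
    intro k
    simp only [mulVec, dotProduct]
    rw [hy (fun i => M (e k) i * w i) fun i hi => by simp [hw0 i hi]]
    simp [hwe]
  rw [← h1]
  refine le_trans ?_ (norm_toLp_mulVec_le M w)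
  refine (sq_le_sq₀ (by positivity) (by positivity)).mp ?_
  rw [EuclideanSpace.norm_sq_eq, EuclideanSpace.norm_sq_eq]
  simp only [h2]
  rw [← Finset.sum_image (f := fun i => ‖(M *ᵥ w) i‖ ^ 2) (he.injOn)]
  exact Finset.sum_le_sum_of_subset_of_nonneg (Finset.subset_univ _) fun _ _ _ => by positivity

/-! ### Schur multipliers on the operator norm. -/

/-- The entrywise product of a real matrix with a complex matrix. -/
def realSchurMul {ι : Type*} (S : ι → ι → ℝ) (X : Matrix ι ι ℂ) : Matrix ι ι ℂ :=
  Matrix.of fun j k => (S j k : ℂ) * X j k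

@[simp]
theorem realSchurMul_apply {ι : Type*} (S : ι → ι → ℝ) (X : Matrix ι ι ℂ) (j k : ι) :
    realSchurMul S X j k = (S j k : ℂ) * X j k := rfl

/-- `K` bounds the norm of `X ↦ S ∘ X` (entrywise product) with respect to the operator norm. -/
def SchurBound {ι : Type*} [Fintype ι] [DecidableEq ι] (S : ι → ι → ℝ) (K : ℝ) : Prop :=
  ∀ X : Matrix ι ι ℂ, ‖realSchurMul S X‖ ≤ K * ‖X‖

namespace SchurBound

variable {ι : Type*} [Fintype ι] [DecidableEq ι]

theorem const (a : ℝ) : SchurBound (fun _ _ : ι => a) |a| := by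
  intro X
  have : realSchurMul (fun _ _ : ι => a) X = (a : ℂ) • X := by
    ext j k; simp
  rw [this, norm_smul]
  simp

theorem add {S T : ι → ι → ℝ} {K L : ℝ} (hS : SchurBound S K) (hT : SchurBound T L) :
    SchurBound (fun j k => S j k + T j k) (K + L) := by
  intro X
  have : realSchurMul (fun j k => S j k + T j k) X = realSchurMul S X + realSchurMul T X := by
    ext j k; simp [add_mul]
  rw [this, add_mul]
  exact (norm_add_le _ _).trans (add_le_add (hS X) (hT X))

theorem neg {S : ι → ι → ℝ} {K : ℝ} (hS : SchurBound S K) :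
    SchurBound (fun j k => -S j k) K := by
  intro X
  have : realSchurMul (fun j k => -S j k) X = -realSchurMul S X := by
    ext j k; simp
  rw [this, norm_neg]
  exact hS X

theorem reindex {κ : Type*} [Fintype κ] [DecidableEq κ] {S : ι → ι → ℝ} {K : ℝ}
    (hK : 0 ≤ K) (hS : SchurBound S K) (e : κ ≃ ι) :
    SchurBound (fun j k => S (e j) (e k)) K := by
  intro X
  have : realSchurMul (fun j k => S (e j) (e k)) X =
      (realSchurMul S (X.submatrix e.symm e.symm)).submatrix e e := by
    ext j k; simp
  rw [this]
  refine (Matrix.l2_opNorm_submatrix_le _ e.injective).trans ((hS _).trans ?_)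
  exact mul_le_mul_of_nonneg_left (Matrix.l2_opNorm_submatrix_le _ e.symm.injective) hK

open Matrix in
/-- A bordered Schur multiplier with vanishing corner. -/
theorem border {n : ℕ} {S : Fin (n + 1) → Fin (n + 1) → ℝ} {a μ t : ℝ} (ha : 0 ≤ a)
    (hμ : 0 ≤ μ) (ht0 : μ ≤ t) (ht : a ^ 2 ≤ t * (t - μ)) (h00 : S 0 0 = 0)
    (hrow : ∀ k : Fin n, |S 0 k.succ| ≤ a) (hcol : ∀ k : Fin n, |S k.succ 0| ≤ a)
    (hS : SchurBound (fun j k : Fin n => S j.succ k.succ) μ) : SchurBound S t := by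
  intro X
  have ht' : 0 ≤ t := hμ.trans ht0
  refine l2_opNorm_le_of_forall (by positivity) fun v => ?_
  set p := ‖v 0‖ with hp
  set q := ‖WithLp.toLp 2 (fun k : Fin n => v k.succ)‖ with hq
  have hp0 : 0 ≤ p := norm_nonneg _
  have hq0 : 0 ≤ q := norm_nonneg _
  -- A multiplier acting on a single row can be absorbed into the vector, so it costs only the
  -- supremum of its entries; the zero corner removes `v 0`.
  have hfirst : ‖(realSchurMul S X *ᵥ v) 0‖ ≤ ‖X‖ * (a * q) := by
    set w : Fin (n + 1) → ℂ := fun k => (S 0 k : ℂ) * v k with hw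
    have h1 : (realSchurMul S X *ᵥ v) 0 = (X *ᵥ w) 0 := by
      simp only [mulVec, dotProduct, realSchurMul_apply, hw]
      exact Finset.sum_congr rfl fun _ _ => by ring
    have h2 : ‖WithLp.toLp 2 w‖ ≤ a * q := by
      refine (sq_le_sq₀ (by positivity) (by positivity)).mp ?_
      rw [norm_sq_toLp_fin_succ]
      have : ‖WithLp.toLp 2 (fun k : Fin n => w k.succ)‖ ≤ a * q :=
        norm_toLp_le_of_forall_norm_le ha fun k => by
          simpa [hw] using mul_le_mul_of_nonneg_right (hrow k) (norm_nonneg (v k.succ))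
      have h0 : w 0 = 0 := by simp [hw, h00]
      rw [h0]
      simpa using pow_le_pow_left₀ (norm_nonneg _) this 2
    rw [h1]
    calc ‖(X *ᵥ w) 0‖ ≤ ‖WithLp.toLp 2 (X *ᵥ w)‖ :=
          PiLp.norm_apply_le (WithLp.toLp 2 (X *ᵥ w)) 0
      _ ≤ ‖X‖ * ‖WithLp.toLp 2 w‖ := norm_toLp_mulVec_le X w
      _ ≤ _ := mul_le_mul_of_nonneg_left h2 (norm_nonneg _)
  have hrest : ‖WithLp.toLp 2 (fun k : Fin n => (realSchurMul S X *ᵥ v) k.succ)‖ ≤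
      ‖X‖ * (a * p + μ * q) := by
    set w : Fin (n + 1) → ℂ := X *ᵥ Pi.single 0 (v 0) with hw
    have hsplit : WithLp.toLp 2 (fun k : Fin n => (realSchurMul S X *ᵥ v) k.succ) =
        WithLp.toLp 2 (fun k : Fin n => (S k.succ 0 : ℂ) * w k.succ) +
        WithLp.toLp 2 (realSchurMul (fun j k : Fin n => S j.succ k.succ)
          (X.submatrix Fin.succ Fin.succ) *ᵥ fun k : Fin n => v k.succ) := by
      ext k
      simp [mulVec, dotProduct, Fin.sum_univ_succ, hw, mul_assoc, mul_comm (v 0)]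
    have hw1 : ‖WithLp.toLp 2 (fun k : Fin n => w k.succ)‖ ≤ ‖X‖ * p := by
      have h1 := norm_toLp_mulVec_le X (Pi.single 0 (v 0))
      have h2 : ‖WithLp.toLp 2 (fun k : Fin n => w k.succ)‖ ≤ ‖WithLp.toLp 2 w‖ := by
        refine (sq_le_sq₀ (by positivity) (by positivity)).mp ?_
        rw [norm_sq_toLp_fin_succ w]
        nlinarith [sq_nonneg ‖w 0‖]
      have h3 : ‖WithLp.toLp 2 (Pi.single (0 : Fin (n + 1)) (v 0) : Fin (n + 1) → ℂ)‖ = p := by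
        simp [hp]
      rw [h3] at h1
      exact h2.trans h1
    have h1 : ‖WithLp.toLp 2 (fun k : Fin n => (S k.succ 0 : ℂ) * w k.succ)‖ ≤
        a * (‖X‖ * p) :=
      (norm_toLp_le_of_forall_norm_le ha fun k => by
        simpa using mul_le_mul_of_nonneg_right (hcol k) (norm_nonneg (w k.succ))).trans
        (mul_le_mul_of_nonneg_left hw1 ha)
    have h2 := norm_toLp_mulVec_le (realSchurMul (fun j k : Fin n => S j.succ k.succ)
          (X.submatrix Fin.succ Fin.succ)) fun k : Fin n => v k.succ
    have h3 := (hS (X.submatrix Fin.succ Fin.succ)).trans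
      (mul_le_mul_of_nonneg_left (l2_opNorm_submatrix_le X (Fin.succ_injective n)) hμ)
    have h4 := h2.trans (mul_le_mul_of_nonneg_right h3 hq0)
    rw [hsplit]
    refine (norm_add_le _ _).trans ((add_le_add h1 h4).trans (le_of_eq ?_))
    ring
  refine (sq_le_sq₀ (by positivity) (by positivity)).mp ?_
  rw [norm_sq_toLp_fin_succ, mul_pow, norm_sq_toLp_fin_succ v]
  have e1 := pow_le_pow_left₀ (norm_nonneg _) hfirst 2
  have e2 := pow_le_pow_left₀ (norm_nonneg _) hrest 2
  -- The norm of `[[0, a], [a, μ]]` is the larger root of `t * (t - μ) = a ^ 2`; the estimate is the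
  -- sum of `k1` and `k2`.
  have key : (a * q) ^ 2 + (a * p + μ * q) ^ 2 ≤ t ^ 2 * (p ^ 2 + q ^ 2) := by
    have k1 : t * μ * p ^ 2 + μ * (t - μ) * q ^ 2 ≥ 2 * a * μ * p * q := by
      have hs := Real.sq_sqrt ht'
      have hr := Real.sq_sqrt (sub_nonneg.mpr ht0)
      have hle : a ≤ √t * √(t - μ) := by
        rw [← Real.sqrt_mul ht']
        exact Real.le_sqrt_of_sq_le ht
      have h5 : 0 ≤ μ * (√t * p - √(t - μ) * q) ^ 2 := by positivity
      have h6 : 2 * a * μ * p * q ≤ 2 * (√t * √(t - μ)) * μ * p * q := by gcongr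
      have h7 : μ * (√t * p - √(t - μ) * q) ^ 2 = μ * (√t ^ 2 * p ^ 2 + √(t - μ) ^ 2 * q ^ 2)
        - 2 * (√t * √(t - μ)) * μ * p * q := by ring
      rw [hs, hr] at h7
      nlinarith
    have k2 : (t * (t - μ) - a ^ 2) * (p ^ 2 + q ^ 2) ≥ 0 :=
      mul_nonneg (by linarith) (by positivity)
    nlinarith
  have key' := mul_le_mul_of_nonneg_left key (sq_nonneg ‖X‖)
  rw [← hp, ← hq]
  nlinarith

/-- The Schur multiplier bound for matrices with increasing bounds. -/
theorem of_monotone {n : ℕ} : ∀ (S : Fin n → Fin n → ℝ) (m : Fin n → ℝ) (T : ℝ), 0 ≤ T →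
    Monotone m → (∀ j, 0 ≤ m j) → (∀ j, m j ≤ T) → (∀ j, S j j = m j) →
    (∀ j k, S j k = S k j) → (∀ j k, j < k → m j ≤ S j k ∧ S j k ≤ T) →
    SchurBound S (T + Real.goldenRatio⁻¹ * ∑ j, (T - m j)) := by
  induction n with
  | zero =>
    intro S m T hT _ _ _ _ _ _ X
    have : realSchurMul S X = 0 := Subsingleton.elim _ _
    rw [this]
    simpa using mul_nonneg hT (norm_nonneg X)
  | succ n ih =>
    intro S m T hT hm hm0 hmT hdiag hsymm hS
    set ψ := Real.goldenRatio⁻¹ with hψ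
    have hψ0 : 0 < ψ := inv_pos.mpr Real.goldenRatio_pos
    have hψ2 : ψ + ψ ^ 2 = 1 := by
      have h1 := Real.goldenRatio_sq
      have h2 := Real.goldenRatio_ne_zero
      rw [hψ]
      generalize Real.goldenRatio = x at h1 h2
      field_simp
      linarith
    set a := T - m 0 with ha
    have ha0 : 0 ≤ a := sub_nonneg.mpr (hmT 0)
    have htail := ih (fun j k => S j.succ k.succ - m 0) (fun j => m j.succ - m 0) a ha0
      (fun i j hij => sub_le_sub_right (hm (Fin.succ_le_succ_iff.mpr hij)) _)
      (fun j => sub_nonneg.mpr (hm (Fin.zero_le _)))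
      (fun j => sub_le_sub_right (hmT _) _) (fun j => by simp [hdiag])
      (fun j k => by rw [hsymm]) (fun j k hjk => by
        have := hS _ _ (Fin.succ_lt_succ_iff.mpr hjk)
        constructor <;> linarith)
    set μ := a + ψ * ∑ j : Fin n, (a - (m j.succ - m 0)) with hμ
    have hsum : 0 ≤ ∑ j : Fin n, (a - (m j.succ - m 0)) :=
      Finset.sum_nonneg fun j _ => by have := hmT j.succ; linarith
    have haμ : a ≤ μ := by
      have := mul_nonneg hψ0.le hsum
      linarith
    -- Since `a ≤ μ`, the choice `t = μ + ψ * a` gives `t * (t - μ) ≥ (ψ + ψ ^ 2) * a ^ 2 = a ^ 2`,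
    -- which is what fixes `ψ`.
    have hb := border (S := fun j k => S j k - m 0) (a := a) (μ := μ) (t := μ + ψ * a) ha0
      (ha0.trans haμ) (by have := mul_nonneg hψ0.le ha0; linarith) (by
        have h1 : ψ * a * a ≤ ψ * a * μ := mul_le_mul_of_nonneg_left haμ (by positivity)
        have h2 : a ^ 2 = ψ * a * a + ψ ^ 2 * a ^ 2 := by
          linear_combination (-a ^ 2) * hψ2
        nlinarith) (by simp [hdiag])
      (fun k => by
        have := hS 0 k.succ (Fin.succ_pos k)
        rw [abs_of_nonneg (by linarith)]; linarith)
      (fun k => by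
        have := hS 0 k.succ (Fin.succ_pos k)
        rw [hsymm, abs_of_nonneg (by linarith)]; linarith) htail
    have hfin := hb.add (const (m 0))
    have e1 : (fun j k => S j k - m 0 + m 0) = S := by ext; simp
    have e2 : μ + ψ * a + |m 0| = T + ψ * ∑ j, (T - m j) := by
      rw [Fin.sum_univ_succ, abs_of_nonneg (hm0 0), hμ]
      have : ∀ j : Fin n, a - (m j.succ - m 0) = T - m j.succ := fun j => by rw [ha]; ring
      simp only [this]
      rw [ha]; ring
    rw [e1, e2] at hfin
    exact hfin

end SchurBound

/-! ### Polar decomposition and trace-norm duality. -/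

open Matrix Unitary in
theorem Matrix.l2_opNorm_conjStarAlgAut {ι : Type*} [Fintype ι] [DecidableEq ι]
    (U : unitary (Matrix ι ι ℂ)) (X : Matrix ι ι ℂ) : ‖conjStarAlgAut ℂ _ U X‖ = ‖X‖ := by
  rw [conjStarAlgAut_apply, CStarRing.norm_mul_mem_unitary _ (Unitary.star_mem U.2),
    CStarRing.norm_mem_unitary_mul _ U.2]

open Matrix Unitary in
theorem Matrix.trace_conjStarAlgAut {ι : Type*} [Fintype ι] [DecidableEq ι]
    (U : unitary (Matrix ι ι ℂ)) (X : Matrix ι ι ℂ) :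
    (conjStarAlgAut ℂ _ U X).trace = X.trace := by
  rw [conjStarAlgAut_apply, trace_mul_comm, ← mul_assoc]
  simp

open scoped ComplexOrder in
open Matrix Unitary in
/-- Polar decomposition: `Y = W |Y|` and `Wᴴ Y = |Y|` for a contraction `W`. -/
theorem Matrix.exists_polar {ι : Type*} [Fintype ι] [DecidableEq ι] (Y : Matrix ι ι ℂ) :
    ∃ W : Matrix ι ι ℂ, ‖W‖ ≤ 1 ∧
      W * (isHermitian_conjTranspose_mul_self Y).cfc Real.sqrt = Y ∧
      Wᴴ * Y = (isHermitian_conjTranspose_mul_self Y).cfc Real.sqrt := by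
  set hH := isHermitian_conjTranspose_mul_self Y with hHdef
  have hev : ∀ i, 0 ≤ hH.eigenvalues i :=
    (posSemidef_conjTranspose_mul_self Y).eigenvalues_nonneg
  set Φ := conjStarAlgAut ℂ (Matrix ι ι ℂ) hH.eigenvectorUnitary with hΦ
  set l : ι → ℝ := hH.eigenvalues with hl
  have hHΦ : Yᴴ * Y = Φ (diagonal fun i => (l i : ℂ)) := hH.spectral_theorem
  have hP : hH.cfc Real.sqrt = Φ (diagonal fun i => (√(l i) : ℂ)) := rfl
  have hstar : ∀ d : ι → ℝ, (Φ (diagonal fun i => (d i : ℂ)))ᴴ =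
      Φ (diagonal fun i => (d i : ℂ)) := by
    intro d
    rw [← star_eq_conjTranspose, ← map_star, star_eq_conjTranspose, diagonal_conjTranspose]
    congr 2
    ext i
    simp
  have hmul : ∀ d e : ι → ℝ, Φ (diagonal fun i => (d i : ℂ)) * Φ (diagonal fun i => (e i : ℂ)) =
      Φ (diagonal fun i => ((d i * e i : ℝ) : ℂ)) := by
    intro d e
    rw [← map_mul, diagonal_mul_diagonal]
    simp
  have hgram : ∀ d : ι → ℝ, (Y * Φ (diagonal fun i => (d i : ℂ)))ᴴ *
      (Y * Φ (diagonal fun i => (d i : ℂ))) = Φ (diagonal fun i => ((d i * l i * d i : ℝ) : ℂ)) := by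
    intro d
    rw [conjTranspose_mul, hstar, mul_assoc, ← mul_assoc Yᴴ, hHΦ, ← mul_assoc, hmul, hmul]
  -- With `0⁻¹ = 0`, the matrix `Y * Φ (diagonal r)` is the partial isometry vanishing on the kernel
  -- of `Y`.
  set r : ι → ℝ := fun i => (√(l i))⁻¹ with hr
  refine ⟨Y * Φ (diagonal fun i => (r i : ℂ)), ?_, ?_, ?_⟩
  · have h1 := l2_opNorm_conjTranspose_mul_self (Y * Φ (diagonal fun i => (r i : ℂ)))
    rw [hgram, hΦ, l2_opNorm_conjStarAlgAut, l2_opNorm_diagonal] at h1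
    have h2 : ‖fun i => ((r i * l i * r i : ℝ) : ℂ)‖ ≤ 1 := by
      refine (pi_norm_le_iff_of_nonneg zero_le_one).mpr fun i => ?_
      rw [Complex.norm_real]
      rcases eq_or_ne (√(l i)) 0 with h | h
      · simp [hr, h]
      · have : r i * l i * r i = 1 := by
          have h3 := Real.mul_self_sqrt (hev i)
          rw [hr]
          simp only
          field_simp
          rw [sq]; exact h3.symm
        simp [this]
    rw [h1, ← sq] at h2
    exact (sq_le_one_iff₀ (norm_nonneg _)).mp h2
  · rw [hP, mul_assoc, hmul]
    have h1 : Y - Y * Φ (diagonal fun i => ((r i * √(l i) : ℝ) : ℂ)) =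
        Y * Φ (diagonal fun i => ((1 - r i * √(l i) : ℝ) : ℂ)) := by
      have : (diagonal fun i => ((1 - r i * √(l i) : ℝ) : ℂ)) =
          1 - diagonal fun i => ((r i * √(l i) : ℝ) : ℂ) := by
        rw [← diagonal_one, diagonal_sub]
        simp
      rw [this, map_sub, map_one, mul_sub, mul_one]
    have h2 : Y * Φ (diagonal fun i => ((1 - r i * √(l i) : ℝ) : ℂ)) = 0 := by
      rw [← conjTranspose_mul_self_eq_zero, hgram]
      have : (diagonal fun i => (((1 - r i * √(l i)) * l i * (1 - r i * √(l i)) : ℝ) : ℂ)) = 0 := by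
        rw [diagonal_eq_zero]
        funext i
        rcases eq_or_ne (√(l i)) 0 with h | h
        · have : l i = 0 := (Real.sqrt_eq_zero (hev i)).mp h
          simp [this]
        · simp [hr, h]
      rw [this, map_zero]
    rw [h2] at h1
    exact (sub_eq_zero.mp h1).symm
  · rw [hP, conjTranspose_mul, hstar, mul_assoc, hHΦ, hmul]
    congr 2
    funext i
    have h3 := Real.mul_self_sqrt (hev i)
    rcases eq_or_ne (√(l i)) 0 with h | h
    · simp [hr, h]
    · congr 1
      rw [hr]
      simp only
      field_simp
      rw [sq]; exact h3.symm

open Matrix Unitary in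
/-- Duality of the trace norm and the operator norm. -/
theorem re_trace_mul_le_traceNorm {n : ℕ} (X Y : Matrix (Fin n) (Fin n) ℂ) :
    (X * Y).trace.re ≤ ‖X‖ * traceNorm Y := by
  obtain ⟨W, hW, hWP, -⟩ := exists_polar Y
  set hH := isHermitian_conjTranspose_mul_self Y with hHdef
  set V := hH.eigenvectorUnitary with hV
  set d : Fin n → ℂ := fun i => (√(hH.eigenvalues i) : ℂ) with hd
  have hP : hH.cfc Real.sqrt = conjStarAlgAut ℂ _ V (diagonal d) := rfl
  have htn : traceNorm Y = ∑ i, √(hH.eigenvalues i) := by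
    have h1 : traceNorm Y = (hH.cfc Real.sqrt).trace.re := rfl
    rw [h1, hP, trace_conjStarAlgAut]
    simp [hd]
  -- In the eigenbasis of `|Y|`, the trace of `X * W * |Y|` pairs the diagonal of `Z` with the
  -- singular values of `Y`.
  set Z := (conjStarAlgAut ℂ _ V).symm (X * W) with hZ
  have hZn : ‖Z‖ ≤ ‖X‖ := by
    have h1 : ‖conjStarAlgAut ℂ _ V Z‖ = ‖Z‖ := l2_opNorm_conjStarAlgAut V Z
    rw [hZ, StarAlgEquiv.apply_symm_apply] at h1
    rw [hZ, ← h1]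
    exact (norm_mul_le X W).trans (mul_le_of_le_one_right (norm_nonneg _) hW)
  have htr : (X * Y).trace = (Z * diagonal d).trace := by
    rw [← trace_conjStarAlgAut V (Z * _), map_mul, hZ, StarAlgEquiv.apply_symm_apply, ← hP,
      mul_assoc, hWP]
  rw [htr, htn, Finset.mul_sum, trace, Complex.re_sum]
  refine Finset.sum_le_sum fun i _ => ?_
  rw [diag_apply, mul_diagonal]
  refine (Complex.re_le_norm _).trans ?_
  rw [norm_mul, hd]
  simp only [Complex.norm_real, Real.norm_eq_abs, abs_of_nonneg (Real.sqrt_nonneg _)]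
  exact mul_le_mul_of_nonneg_right ((norm_entry_le_l2_opNorm Z i i).trans hZn) (Real.sqrt_nonneg _)

open Matrix Unitary in
/-- A Schur multiplier bound for the operator norm transfers to the trace norm, in any orthonormal
basis. -/
theorem SchurBound.traceNorm_le {n : ℕ} {S : Fin n → Fin n → ℝ} {K : ℝ} (hS : SchurBound S K)
    (hsymm : ∀ j k, S j k = S k j) (hK : 0 ≤ K) (U : unitary (Matrix (Fin n) (Fin n) ℂ))
    (Y : Matrix (Fin n) (Fin n) ℂ) :
    traceNorm (conjStarAlgAut ℂ _ U (realSchurMul S Y)) ≤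
      K * traceNorm (conjStarAlgAut ℂ _ U Y) := by
  set Φ := conjStarAlgAut ℂ (Matrix (Fin n) (Fin n) ℂ) U with hΦ
  obtain ⟨W, hW, -, hWY⟩ := exists_polar (Φ (realSchurMul S Y))
  set Z := Φ.symm Wᴴ with hZ
  have hΦZ : Φ Z = Wᴴ := StarAlgEquiv.apply_symm_apply _ _
  have hZn : ‖Z‖ ≤ 1 := by
    rw [← l2_opNorm_conjStarAlgAut U, ← hΦ, hΦZ, l2_opNorm_conjTranspose]
    exact hW
  -- Under the trace pairing the adjoint of a Schur multiplier is its transpose, here itself.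
  have hswap : (Z * realSchurMul S Y).trace = (realSchurMul S Z * Y).trace := by
    simp only [trace, diag_apply, mul_apply, realSchurMul_apply]
    refine Finset.sum_congr rfl fun j _ => Finset.sum_congr rfl fun k _ => ?_
    rw [hsymm k j]; ring
  have hnn : 0 ≤ traceNorm (Φ Y) := by
    rw [traceNorm, Matrix.IsHermitian.cfc, trace_conjStarAlgAut, trace_diagonal, Complex.re_sum]
    exact Finset.sum_nonneg fun i _ => by simp [Real.sqrt_nonneg]
  calc traceNorm (Φ (realSchurMul S Y)) = (Wᴴ * Φ (realSchurMul S Y)).trace.re := by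
        rw [hWY]; rfl
    _ = (realSchurMul S Z * Y).trace.re := by
        rw [← hΦZ, ← map_mul, trace_conjStarAlgAut, hswap]
    _ = (Φ (realSchurMul S Z) * Φ Y).trace.re := by rw [← map_mul, trace_conjStarAlgAut]
    _ ≤ ‖Φ (realSchurMul S Z)‖ * traceNorm (Φ Y) := re_trace_mul_le_traceNorm _ _
    _ ≤ K * traceNorm (Φ Y) := by
        refine mul_le_mul_of_nonneg_right ?_ hnn
        rw [hΦ, l2_opNorm_conjStarAlgAut]
        exact (hS Z).trans (mul_le_of_le_one_right hK hZn)

/-- The eigenvalues of a Hermitian matrix are a rearrangement of its sorted spectrum. -/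
theorem IsSortedSpectrum.exists_perm {n : ℕ} {C : Matrix (Fin n) (Fin n) ℂ} (hC : C.IsHermitian)
    {c : Fin n → ℝ} (hc : IsSortedSpectrum C c) :
    ∃ σ : Equiv.Perm (Fin n), ∀ i, hC.eigenvalues i = c (σ i) := by
  have hroots : Multiset.map (fun j => (c j : ℂ)) Finset.univ.val =
      Multiset.map (fun j => (hC.eigenvalues j : ℂ)) Finset.univ.val := by
    have h1 := hC.roots_charpoly_eq_eigenvalues
    rw [hc.2, Polynomial.roots_prod _ _ (Finset.prod_ne_zero_iff.mpr fun j _ =>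
      Polynomial.X_sub_C_ne_zero _)] at h1
    simpa [Function.comp_def] using h1
  set τ := Tuple.sort hC.eigenvalues with hτ
  have hτm : Monotone (hC.eigenvalues ∘ τ) := Tuple.monotone_sort _
  have hmap : Multiset.map c Finset.univ.val =
      Multiset.map (hC.eigenvalues ∘ τ) Finset.univ.val := by
    rw [← Multiset.map_map, Multiset.map_univ_val_equiv]
    apply Multiset.map_injective Complex.ofReal_injective
    rw [Multiset.map_map, Multiset.map_map]
    exact hroots
  have hperm : (List.ofFn c).Perm (List.ofFn (hC.eigenvalues ∘ τ)) := by
    rw [Fin.univ_val_map, Fin.univ_val_map] at hmap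
    exact Multiset.coe_eq_coe.mp hmap
  have heq : c = hC.eigenvalues ∘ τ :=
    List.ofFn_injective (hperm.eq_of_pairwise'
      hc.1.sortedLE_ofFn.pairwise hτm.sortedLE_ofFn.pairwise)
  exact ⟨τ⁻¹, fun i => by simp [heq]⟩

/-! ### Loewner matrices of concave functions. -/

/-- The Loewner matrix of divided differences, with prescribed values at coinciding nodes. -/
noncomputable def loewnerMatrix {ι : Type*} (f f' : ℝ → ℝ) (b : ι → ℝ) (j k : ι) : ℝ :=
  if b j = b k then f' (b j) else slope f (b j) (b k)

theorem loewnerMatrix_comm {ι : Type*} (f f' : ℝ → ℝ) (b : ι → ℝ) (j k : ι) :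
    loewnerMatrix f f' b j k = loewnerMatrix f f' b k j := by
  unfold loewnerMatrix
  by_cases h : b j = b k
  · simp [h]
  · rw [if_neg h, if_neg (Ne.symm h), slope_comm]

theorem loewnerMatrix_mul_sub {ι : Type*} (f f' : ℝ → ℝ) (b : ι → ℝ) (j k : ι) :
    loewnerMatrix f f' b j k * (b k - b j) = f (b k) - f (b j) := by
  unfold loewnerMatrix
  split_ifs with h
  · simp [h]
  · rw [mul_comm]; exact sub_smul_slope f (b j) (b k)

theorem ConcaveOn.loewnerMatrix_mem_Icc {n : ℕ} {f f' : ℝ → ℝ} {s : Set ℝ}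
    (hf : ConcaveOn ℝ s f) {b : Fin n → ℝ} (hb : Monotone b) (hbs : ∀ j, b j ∈ s)
    (hf' : ∀ j, HasDerivWithinAt f (f' (b j)) s (b j)) {j k : Fin n} (hjk : j ≤ k) :
    loewnerMatrix f f' b j k ∈ Set.Icc (f' (b k)) (f' (b j)) := by
  unfold loewnerMatrix
  split_ifs with h
  · simp [h]
  · have hlt := lt_of_le_of_ne (hb hjk) h
    exact ⟨hf.le_slope_of_hasDerivWithinAt (hbs j) (hbs k) hlt (hf' k),
      hf.slope_le_of_hasDerivWithinAt (hbs j) (hbs k) hlt (hf' j)⟩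

/-- The diagonal of `L - β` decreases, so the indices are reversed before applying `of_monotone`
with `T = α - β`. Adding the constant `β` back costs `|β|`. -/
theorem SchurBound.loewnerMatrix_abs_right {n : ℕ} {L : Fin n → Fin n → ℝ} {a : Fin n → ℝ}
    {α β : ℝ} (hαβ : β ≤ α) (ha : Antitone a) (hβ : ∀ j, β ≤ a j) (hα : ∀ j, a j ≤ α)
    (hdiag : ∀ j, L j j = a j) (hsymm : ∀ j k, L j k = L k j)
    (hL : ∀ j k, j ≤ k → L j k ∈ Set.Icc (a k) (a j)) :
    SchurBound L (α - β + (|β| + Real.goldenRatio⁻¹ * ∑ j, (α - a j))) := by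
  have h := of_monotone (fun j k => L j.rev k.rev - β) (fun j => a j.rev - β) (α - β)
    (sub_nonneg.mpr hαβ) (fun i j hij => sub_le_sub_right (ha (Fin.rev_le_rev.mpr hij)) β)
    (fun j => sub_nonneg.mpr (hβ _)) (fun j => sub_le_sub_right (hα _) β)
    (fun j => by rw [hdiag]) (fun j k => by rw [hsymm]) (fun j k hjk => by
      have := hL _ _ (Fin.rev_le_rev.mpr hjk.le)
      rw [hsymm] at this
      exact ⟨sub_le_sub_right this.1 β, sub_le_sub_right (this.2.trans (hα _)) β⟩)
  have hsum : ∑ j : Fin n, (α - β - (a j.rev - β)) = ∑ j, (α - a j) := by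
    rw [← Equiv.sum_comp Fin.revPerm (fun j => α - a j)]
    exact Finset.sum_congr rfl fun j _ => by simp
  rw [hsum] at h
  have h0 : 0 ≤ α - β + Real.goldenRatio⁻¹ * ∑ j, (α - a j) :=
    add_nonneg (sub_nonneg.mpr hαβ) (mul_nonneg (inv_nonneg.mpr Real.goldenRatio_pos.le)
      (Finset.sum_nonneg fun j _ => sub_nonneg.mpr (hα j)))
  have h2 := (h.reindex h0 Fin.revPerm).add (const β)
  convert h2 using 1
  · ext; simp
  · ring

/-- The diagonal of `α - L` already increases, so no reversal is needed. Writing `L = -(α - L) + α`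
costs `|α|`. -/
theorem SchurBound.loewnerMatrix_abs_left {n : ℕ} {L : Fin n → Fin n → ℝ} {a : Fin n → ℝ}
    {α β : ℝ} (hαβ : β ≤ α) (ha : Antitone a) (hβ : ∀ j, β ≤ a j) (hα : ∀ j, a j ≤ α)
    (hdiag : ∀ j, L j j = a j) (hsymm : ∀ j k, L j k = L k j)
    (hL : ∀ j k, j ≤ k → L j k ∈ Set.Icc (a k) (a j)) :
    SchurBound L (α - β + (|α| + Real.goldenRatio⁻¹ * ∑ j, (a j - β))) := by
  have h := of_monotone (fun j k => α - L j k) (fun j => α - a j) (α - β)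
    (sub_nonneg.mpr hαβ) (fun i j hij => sub_le_sub_left (ha hij) α)
    (fun j => sub_nonneg.mpr (hα _)) (fun j => sub_le_sub_left (hβ _) α)
    (fun j => by rw [hdiag]) (fun j k => by rw [hsymm]) (fun j k hjk => by
      have := hL _ _ hjk.le
      exact ⟨sub_le_sub_left this.2 α, sub_le_sub_left ((hβ _).trans this.1) α⟩)
  have hsum : ∑ j : Fin n, (α - β - (α - a j)) = ∑ j, (a j - β) :=
    Finset.sum_congr rfl fun j _ => by ring
  rw [hsum] at h
  have h2 := h.neg.add (const α)
  convert h2 using 1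
  · ext; simp
  · ring

/-! ### Commutators and the final estimate. -/

open Matrix Unitary in
/-- In an eigenbasis of `C`, the commutator with `h(C)` is a Schur multiple of the commutator
with `g(C)`. -/
theorem Matrix.IsHermitian.lie_cfc {n : ℕ} (A : Matrix (Fin n) (Fin n) ℂ)
    {C : Matrix (Fin n) (Fin n) ℂ} (hC : C.IsHermitian) (g : ℝ → ℝ) :
    ⁅A, hC.cfc g⁆ = conjStarAlgAut ℂ _ hC.eigenvectorUnitary (of fun j k =>
      (conjStarAlgAut ℂ _ hC.eigenvectorUnitary).symm A j k *
        ((g (hC.eigenvalues k) - g (hC.eigenvalues j) : ℝ) : ℂ)) := by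
  set Φ := conjStarAlgAut ℂ (Matrix (Fin n) (Fin n) ℂ) hC.eigenvectorUnitary with hΦ
  have hcfc : hC.cfc g = Φ (diagonal fun i => (g (hC.eigenvalues i) : ℂ)) := rfl
  have hA : A = Φ (Φ.symm A) := (StarAlgEquiv.apply_symm_apply _ _).symm
  conv_lhs => rw [hA]
  rw [hcfc, Ring.lie_def, ← map_mul, ← map_mul, ← map_sub]
  congr 1
  ext j k
  simp only [sub_apply, mul_diagonal, diagonal_mul, of_apply]
  push_cast
  ring

theorem mainTheorem9 {n : ℕ} (hn : 0 < n)
    (A C : Matrix (Fin n) (Fin n) ℂ) (hC : C.IsHermitian)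
    (c : Fin n → ℝ) (hc : IsSortedSpectrum C c)
    -- `D` is a common domain of the functions `g` and `h`
    (D : Set ℝ) (hD : ∀ j, c j ∈ D)
    (g h : ℝ → ℝ) (hg : StrictMonoOn g D)
    -- `f = h ∘ g⁻¹` on `g(D)`
    (f : ℝ → ℝ) (hf : ∀ x ∈ D, f (g x) = h x)
    (b₁ bₙ : ℝ) (hb₁ : b₁ = g (c ⟨0, hn⟩))
    (hbₙ : bₙ = g (c ⟨n - 1, Nat.sub_lt hn Nat.one_pos⟩))
    (hconc : ConcaveOn ℝ (Set.Icc b₁ bₙ) f)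
    -- `f'` is the derivative of `f` at the points `g(c_j)` (one-sided at the end points)
    (f' : ℝ → ℝ)
    (hf' : ∀ j, HasDerivWithinAt f (f' (g (c j))) (Set.Icc b₁ bₙ) (g (c j)))
    (α β : ℝ) (hα : α = f' b₁) (hβ : β = f' bₙ) :
    traceNorm ⁅A, hC.cfc h⁆ ≤
      ((α - β) +
        min (|β| + Real.goldenRatio⁻¹ * ∑ j, (α - f' (g (c j))))
            (|α| + Real.goldenRatio⁻¹ * ∑ j, (f' (g (c j)) - β))) *
      traceNorm ⁅A, hC.cfc g⁆ := by
  set b : Fin n → ℝ := fun j => g (c j) with hb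
  set lo : Fin n := ⟨0, hn⟩ with hlo
  set hi : Fin n := ⟨n - 1, Nat.sub_lt hn Nat.one_pos⟩ with hhi
  have hlo_le : ∀ j, lo ≤ j := fun j => Fin.mk_le_of_le_val (Nat.zero_le _)
  have hle_hi : ∀ j, j ≤ hi := fun j => Fin.le_def.mpr (Nat.le_sub_one_of_lt j.2)
  have hbm : Monotone b := fun i j hij => hg.monotoneOn (hD i) (hD j) (hc.1 hij)
  have hbs : ∀ j, b j ∈ Set.Icc b₁ bₙ := fun j => by
    rw [hb₁, hbₙ]; exact ⟨hbm (hlo_le j), hbm (hle_hi j)⟩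
  set L := loewnerMatrix f f' b with hL
  set a : Fin n → ℝ := fun j => f' (b j) with ha
  have hLmem : ∀ j k, j ≤ k → L j k ∈ Set.Icc (a k) (a j) := fun j k hjk =>
    hconc.loewnerMatrix_mem_Icc hbm hbs hf' hjk
  have ham : Antitone a := fun j k hjk => (hLmem j k hjk).1.trans (hLmem j k hjk).2
  have haα : ∀ j, a j ≤ α := fun j => by rw [hα, hb₁]; exact ham (hlo_le j)
  have haβ : ∀ j, β ≤ a j := fun j => by rw [hβ, hbₙ]; exact ham (hle_hi j)
  have hαβ : β ≤ α := (haβ lo).trans (haα lo)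
  have hdiag : ∀ j, L j j = a j := fun j => by simp [hL, loewnerMatrix, ha]
  have hsymm : ∀ j k, L j k = L k j := loewnerMatrix_comm f f' b
  have hψ : 0 ≤ Real.goldenRatio⁻¹ := inv_nonneg.mpr Real.goldenRatio_pos.le
  have hbound : SchurBound L ((α - β) +
      min (|β| + Real.goldenRatio⁻¹ * ∑ j, (α - a j))
          (|α| + Real.goldenRatio⁻¹ * ∑ j, (a j - β))) := by
    rcases min_choice (|β| + Real.goldenRatio⁻¹ * ∑ j, (α - a j))
      (|α| + Real.goldenRatio⁻¹ * ∑ j, (a j - β)) with h | h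
    · rw [h]; exact SchurBound.loewnerMatrix_abs_right hαβ ham haβ haα hdiag hsymm hLmem
    · rw [h]; exact SchurBound.loewnerMatrix_abs_left hαβ ham haβ haα hdiag hsymm hLmem
  have hK : 0 ≤ (α - β) + min (|β| + Real.goldenRatio⁻¹ * ∑ j, (α - a j))
      (|α| + Real.goldenRatio⁻¹ * ∑ j, (a j - β)) :=
    add_nonneg (sub_nonneg.mpr hαβ) (le_min
      (add_nonneg (abs_nonneg _) (mul_nonneg hψ
        (Finset.sum_nonneg fun j _ => sub_nonneg.mpr (haα j))))
      (add_nonneg (abs_nonneg _) (mul_nonneg hψ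
        (Finset.sum_nonneg fun j _ => sub_nonneg.mpr (haβ j)))))
  obtain ⟨σ, hσ⟩ := hc.exists_perm hC
  -- The eigenbasis lists the eigenvalues in its own order, so the multiplier is permuted by `σ` to
  -- match.
  have hmain := (hbound.reindex hK σ).traceNorm_le (fun j k => hsymm _ _) hK
    hC.eigenvectorUnitary (Matrix.of fun j k =>
      (Unitary.conjStarAlgAut ℂ _ hC.eigenvectorUnitary).symm A j k *
        ((g (hC.eigenvalues k) - g (hC.eigenvalues j) : ℝ) : ℂ))
  rw [← hC.lie_cfc A g] at hmain
  convert hmain using 2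
  rw [hC.lie_cfc A h]
  congr 1
  ext j k
  have key := loewnerMatrix_mul_sub f f' b (σ j) (σ k)
  rw [← hL] at key
  simp only [hb, hf _ (hD _)] at key
  rw [realSchurMul_apply, Matrix.of_apply, Matrix.of_apply, hσ, hσ, ← key]
  push_cast
  ring
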